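/- **Theorem (Indirect Matching).** *Model.* On a probability space, for each $n$ let $\boldsymbol\alpha_i=\boldsymbol\alpha_{i}^{(n)}$, $1\le i\le n$, be random vectors in $\mathbb R^r$ ($r\ge1$ fixed), let $\eta_l=\eta_l^{(n)}:\mathbb R^r\to\mathbb R$, $1\le l\le p=p_n$, be random functions, and let $u_{il}=u_{il}^{(n)}$ be real random variables. Let $\mathscr F=\mathscr F_n$ be the $\sigma$-field generated by $(\boldsymbol\alpha_i)_{i\le n}$ and $(\eta_l)_{l\le p}$, and assume $\mathbb E[u_{il}\mid\mathscr F]=0$. Let $\boldsymbol H=(\eta_l(\boldsymbol\alpha_i))_{l,i}$, $\boldsymbol U=(u_{il})_{l,i}$ and $\boldsymbol X=\boldsymbol H+\boldsymbol U$ be the $p\times n$ matrices whose $i$-th column belongs to unit $i$. Fix a set $\mathcal R^\dagger=\mathcal R^\dagger_n\subseteq\{1,\dots,p\}$ of rows, and let $\boldsymbol X^\dagger,\boldsymbol H^\dagger$ be the submatrices with these rows. Let $\rho=\rho_n$ be any rule that assigns to a matrix with columns $\boldsymbol v_1,\dots,\boldsymbol v_n$ real numbers $\rho(\boldsymbol v_i,\boldsymbol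 v_j)$, $1\le i,j\le n$. The number $\rho(\boldsymbol v_i,\boldsymbol v_j)$ may also depend on $i$, $j$ and the other columns, and no metric axioms are required. *Notation.* For random variables $Z_n$ and numbers $b_n>0$, $Z_n\lesssim_{\mathbb P}b_n$ (also written $Z_n=O_P(b_n)$) means $\lim_{\varepsilon\to\infty}\limsup_n\mathbb P[|Z_n/b_n|\ge\varepsilon]=0$, and $Z_n\gtrsim_{\mathbb P}1$ means $\lim_{\varepsilon\to\infty}\limsup_n\mathbb P[\varepsilon Z_n\le 1]=0$. $\mathbb P$ of a non-measurable set is outer probability. *Regularity conditions.* (a) For each $n$, $(\boldsymbol\alpha_i)_{i\le n}$ is i.i.d. with a Lebesgue density supported on a fixed compact convex set $\mathcal A\subset\mathbb R^r$; the density satisfies $c\le f_n\le C$ on $\mathcal A$ with constants $0<c\le C$ not depending on $n$. (b) For some integer $\bar m\ge2$, almost surely every $\eta_l$ is $\bar m$-times continuously differentiable on $\mathcal A$, with all partial derivatives of order at most $\bar m$ bounded on $\mathcal A$ by a universal constant. (c) The $u_{il}$ are independent over $i$ and $l$ conditionally on $\mathscr F$, and for some $\nu>0$, $\max_{i,l}\mathbb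 E[|u_{il}|^{2+\nu}\mid\mathscr F]<\infty$ almost surely. *Indirect matching condition.* For constants $\rho_0\ge0$, $\underline\varsigma>0$, $\bar\varsigma>0$ and a positive sequence $a_n\to0$: (a) $\displaystyle\max_{i\ne j}\big|\rho(\boldsymbol X^\dagger_{\cdot i},\boldsymbol X^\dagger_{\cdot j})-\rho(\boldsymbol H^\dagger_{\cdot i},\boldsymbol H^\dagger_{\cdot j})-\rho_0\big|\lesssim_{\mathbb P}a_n$; (b) $\displaystyle\max_{\boldsymbol\alpha_i\ne\boldsymbol\alpha_j}\frac{\rho(\boldsymbol H^\dagger_{\cdot i},\boldsymbol H^\dagger_{\cdot j})}{\|\boldsymbol\alpha_i-\boldsymbol\alpha_j\|^{\bar\varsigma}}\lesssim_{\mathbb P}1$ and $\displaystyle\min_{\boldsymbol\alpha_i\ne\boldsymbol\alpha_j}\frac{\rho(\boldsymbol H^\dagger_{\cdot i},\boldsymbol H^\dagger_{\cdot j})}{\|\boldsymbol\alpha_i-\boldsymbol\alpha_j\|^{\underline\varsigma}}\gtrsim_{\mathbb P}1$. *Nearest neighbours.* Let $1\le K=K_n\le n$, and for each unit $i$ let $j_1(i),\dots,j_K(i)$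 be distinct indices of $K$ nearest neighbours of $i$ in terms of $\rho(\boldsymbol X^\dagger_{\cdot i},\cdot)$, that is, $\rho(\boldsymbol X^\dagger_{\cdot i},\boldsymbol X^\dagger_{\cdot j_k(i)})\le\rho(\boldsymbol X^\dagger_{\cdot i},\boldsymbol X^\dagger_{\cdot\ell})$ for all $k$ and all $\ell\notin\{j_1(i),\dots,j_K(i)\}$. The unit $i$ itself is an admissible neighbour, and ties are broken in an arbitrary way. *Conclusion.* If $\log(n/K)/K\to0$ and $K\log n/n\to0$ as $n\to\infty$, then $$\max_{1\le i\le n}\max_{1\le k\le K}\|\boldsymbol\alpha_i-\boldsymbol\alpha_{j_k(i)}\|\lesssim_{\mathbb P}(K/n)^{\bar\varsigma/(\underline\varsigma r)}+a_n^{1/\underline\varsigma}.$$ -/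

import Mathlib

open MeasureTheory ProbabilityTheory Filter Topology
open scoped ENNReal

namespace IndirectMatching

/-! ### Stochastic orders -/

/-- `Z n ≲_P b n`: the `limsup` in `n` of `P[|Z n / b n| ≥ ε]` tends to `0` as `ε → ∞`. -/
def IsBigOP {Ω : Type*} [MeasurableSpace Ω] (P : Measure Ω) (Z : ℕ → Ω → ℝ) (b : ℕ → ℝ) : Prop :=
  Tendsto (fun ε : ℝ => limsup (fun n => P {ω | ε ≤ |Z n ω / b n|}) atTop) atTop (𝓝 0)

/-- `Z n ≳_P b n` for positive `b n`: the `limsup` in `n` of `P[b n / Z n ≥ ε]` tends to `0` as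
`ε → ∞`, where a nonpositive value of `Z n` counts as `b n / Z n = ∞`. -/
def IsBigOmegaP {Ω : Type*} [MeasurableSpace Ω] (P : Measure Ω) (Z : ℕ → Ω → ℝ) (b : ℕ → ℝ) :
    Prop :=
  Tendsto (fun ε : ℝ => limsup (fun n => P {ω | ε * Z n ω ≤ b n}) atTop) atTop (𝓝 0)

/-! ### Conditional notions relative to a sub-σ-field -/

/-- Conditional independence of a family of real random variables given the σ-field `m`:
conditional probabilities of finite intersections factor almost surely. -/
def CondIndepFamily {Ω ι : Type*} [MeasurableSpace Ω] (P : Measure Ω) (m : MeasurableSpace Ω)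
    (X : ι → Ω → ℝ) : Prop :=
  ∀ (S : Finset ι) (B : ι → Set ℝ), (∀ i, MeasurableSet (B i)) →
    P⟦⋂ i ∈ S, X i ⁻¹' B i | m⟧ =ᵐ[P] fun ω => ∏ i ∈ S, (P⟦X i ⁻¹' B i | m⟧) ω

/-- The conditional mean of `X` given `m` exists and vanishes almost surely: `E[|X| | m] < ∞` and
`E[X⁺ | m] = E[X⁻ | m]`, with conditional expectations of `[0, ∞]`-valued random variables
(so `X` need not be unconditionally integrable). -/
def CondMeanZero {Ω : Type*} [MeasurableSpace Ω] (P : Measure Ω) (m : MeasurableSpace Ω)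
    (X : Ω → ℝ) : Prop :=
  (∀ᵐ ω ∂P, condLExp m P (fun ω => ENNReal.ofReal |X ω|) ω < ∞) ∧
    condLExp m P (fun ω => ENNReal.ofReal (X ω)) =ᵐ[P]
      condLExp m P (fun ω => ENNReal.ofReal (-X ω))

/-! ### The nonlinear factor model -/

/-- The random elements of the nonlinear factor model with `n` units, `p` features and `r` latent
variables: `α i` is the latent vector of unit `i`, `η ω l` is the (random) latent function of
feature `l`, and `u i l` is the idiosyncratic error. -/
structure FactorModel (Ω : Type*) [MeasurableSpace Ω] (r n p : ℕ) where
  α : Fin n → Ω → EuclideanSpace ℝ (Fin r)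
  η : Ω → Fin p → EuclideanSpace ℝ (Fin r) → ℝ
  u : Fin n → Fin p → Ω → ℝ
  measurable_α : ∀ i, Measurable (α i)
  measurable_η : ∀ l a, Measurable fun ω => η ω l a
  measurable_u : ∀ i l, Measurable (u i l)

namespace FactorModel

variable {Ω : Type*} [MeasurableSpace Ω] {r n p : ℕ}

/-- The noise-free matrix `H`: its `i`-th column is `(η_1(α_i), …, η_p(α_i))`. -/
def H (M : FactorModel Ω r n p) (ω : Ω) : Fin n → Fin p → ℝ :=
  fun i l => M.η ω l (M.α i ω)

/-- The observed data matrix `X = H + U`, as the family of its columns. -/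
def X (M : FactorModel Ω r n p) (ω : Ω) : Fin n → Fin p → ℝ :=
  fun i l => M.H ω i l + M.u i l ω

/-- The σ-field generated by the latent variables and the latent functions. -/
abbrev sigmaF (M : FactorModel Ω r n p) : MeasurableSpace Ω :=
  (⨆ i, MeasurableSpace.comap (M.α i) inferInstance) ⊔
    ⨆ l, ⨆ a, MeasurableSpace.comap (fun ω => M.η ω l a) inferInstance

end FactorModel

/-- The submatrix of a `p × n` matrix (given by its columns) with row indices in `R`. -/
def rows {n p : ℕ} (R : Finset (Fin p)) (Y : Fin n → Fin p → ℝ) : Fin n → R → ℝ :=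
  fun i l => Y i l

/-! ### Standing assumptions -/

/-- The error terms have conditional mean zero given the latent variables and functions. -/
def ErrorsCentered {Ω : Type*} [MeasurableSpace Ω] (P : Measure Ω) {r : ℕ} {p : ℕ → ℕ}
    (M : ∀ n, FactorModel Ω r n (p n)) : Prop :=
  ∀ n i l, CondMeanZero P (M n).sigmaF ((M n).u i l)

/-- The latent vectors are i.i.d. on the compact convex support `A`, with Lebesgue densities that
are bounded and bounded away from zero on `A`, with bounds that do not depend on `n`. -/
def RegularLatent {Ω : Type*} [MeasurableSpace Ω] (P : Measure Ω) {r : ℕ} {p : ℕ → ℕ}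
    (A : Set (EuclideanSpace ℝ (Fin r))) (M : ∀ n, FactorModel Ω r n (p n)) : Prop :=
  IsCompact A ∧ Convex ℝ A ∧ (∀ n, iIndepFun (M n).α P) ∧
    ∃ (f : ℕ → EuclideanSpace ℝ (Fin r) → ℝ) (c C : ℝ), 0 < c ∧
      (∀ n, Measurable (f n)) ∧ (∀ n, ∀ a ∈ A, c ≤ f n a ∧ f n a ≤ C) ∧
      ∀ n i, P.map ((M n).α i) =
        (volume.restrict A).withDensity fun a => ENNReal.ofReal (f n a)

/-- Almost surely, each latent function is `m`-times continuously differentiable on `A` for some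
`m ≥ 2`, with all partial derivatives of order at most `m` bounded by a universal constant.
Derivatives are taken within `A`. -/
def RegularFunctions {Ω : Type*} [MeasurableSpace Ω] (P : Measure Ω) {r : ℕ} {p : ℕ → ℕ}
    (A : Set (EuclideanSpace ℝ (Fin r))) (M : ∀ n, FactorModel Ω r n (p n)) : Prop :=
  ∃ (m : ℕ) (C : ℝ), 2 ≤ m ∧ ∀ n, ∀ᵐ ω ∂P, ∀ l,
    ContDiffOn ℝ m ((M n).η ω l) A ∧
    ∀ k ≤ m, ∀ q : Fin k → Fin r, ∀ a ∈ A,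
      |iteratedFDerivWithin ℝ k ((M n).η ω l) A a
        (fun s => EuclideanSpace.single (q s) (1 : ℝ))| ≤ C

/-- The errors are independent over units and features conditionally on the latent variables and
functions, with a finite conditional moment of order `2 + ν` for some `ν > 0`. -/
def RegularErrors {Ω : Type*} [MeasurableSpace Ω] (P : Measure Ω) {r : ℕ} {p : ℕ → ℕ}
    (M : ∀ n, FactorModel Ω r n (p n)) : Prop :=
  (∀ n, CondIndepFamily P (M n).sigmaF fun q : Fin n × Fin (p n) => (M n).u q.1 q.2) ∧
    ∃ ν : ℝ, 0 < ν ∧ ∀ n, ∀ᵐ ω ∂P, ∀ i l,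
      condLExp (M n).sigmaF P
        (fun ω' => ENNReal.ofReal (|(M n).u i l ω'| ^ (2 + ν))) ω < ∞

/-! ### Distances and nearest neighbours -/

/-- A rule that assigns to the matrix with columns `V 1, …, V n` a "distance" between any two of its
columns. The rule may use the whole matrix, as the pseudo-max distance does; a function
`d` of two vectors gives the rule `fun V i j => d (V i) (V j)`. No metric axioms are imposed. -/
abbrev DistanceRule (n : ℕ) (κ : Type*) := (Fin n → κ → ℝ) → Fin n → Fin n → ℝ

/-- The distance denoises the data up to `a n`: for distinct units, the distance between the
observed columns is that between the noise-free columns plus `ρ₀`, up to `O_P(a n)` uniformly. -/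
def Denoises {Ω : Type*} [MeasurableSpace Ω] (P : Measure Ω) {r : ℕ} {p : ℕ → ℕ}
    (M : ∀ n, FactorModel Ω r n (p n)) (R : ∀ n, Finset (Fin (p n)))
    (ρ : ∀ n, DistanceRule n (R n)) (ρ₀ : ℝ) (a : ℕ → ℝ) : Prop :=
  IsBigOP P
    (fun n ω => ⨆ q : {q : Fin n × Fin n // q.1 ≠ q.2},
      |ρ n (rows (R n) ((M n).X ω)) q.1.1 q.1.2 -
        ρ n (rows (R n) ((M n).H ω)) q.1.1 q.1.2 - ρ₀|) a

/-- The noise-free distance is at most of the order of the power `s` of the latent distance. -/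
def UpperPower {Ω : Type*} [MeasurableSpace Ω] (P : Measure Ω) {r : ℕ} {p : ℕ → ℕ}
    (M : ∀ n, FactorModel Ω r n (p n)) (R : ∀ n, Finset (Fin (p n)))
    (ρ : ∀ n, DistanceRule n (R n)) (s : ℝ) : Prop :=
  IsBigOP P
    (fun n ω => ⨆ q : {q : Fin n × Fin n // (M n).α q.1 ω ≠ (M n).α q.2 ω},
      ρ n (rows (R n) ((M n).H ω)) q.1.1 q.1.2 /
        ‖(M n).α q.1.1 ω - (M n).α q.1.2 ω‖ ^ s) (fun _ => 1)

/-- The noise-free distance is at least of the order of the power `s` of the latent distance. -/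
def LowerPower {Ω : Type*} [MeasurableSpace Ω] (P : Measure Ω) {r : ℕ} {p : ℕ → ℕ}
    (M : ∀ n, FactorModel Ω r n (p n)) (R : ∀ n, Finset (Fin (p n)))
    (ρ : ∀ n, DistanceRule n (R n)) (s : ℝ) : Prop :=
  IsBigOmegaP P
    (fun n ω => ⨅ q : {q : Fin n × Fin n // (M n).α q.1 ω ≠ (M n).α q.2 ω},
      ρ n (rows (R n) ((M n).H ω)) q.1.1 q.1.2 /
        ‖(M n).α q.1.1 ω - (M n).α q.1.2 ω‖ ^ s) (fun _ => 1)

/-- `j i 1, …, j i K` enumerates `K` nearest neighbours of each unit `i` with respect to the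
pairwise distances `d`: they are distinct, and no unit outside the list is strictly closer to `i`
than a unit in the list. Ties may be broken in any way. -/
def IsNearestNeighbors {n K : ℕ} (d : Fin n → Fin n → ℝ) (j : Fin n → Fin K → Fin n) : Prop :=
  ∀ i, Function.Injective (j i) ∧
    ∀ k ℓ, ℓ ∉ Set.range (j i) → d i (j i k) ≤ d i ℓ

/-- The set of all `j` such that at most `K` units `ℓ` have `d i ℓ ≤ d i j`. -/
noncomputable def neighborSet {n : ℕ} (d : Fin n → Fin n → ℝ) (K : ℕ) (i : Fin n) :
    Finset (Fin n) :=
  Finset.univ.filter fun j => (Finset.univ.filter fun ℓ => d i ℓ ≤ d i j).card ≤ K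

/-- Every member of `neighborSet` occurs in every enumeration of nearest neighbours. -/
theorem neighborSet_subset {n K : ℕ} {d : Fin n → Fin n → ℝ} {j : Fin n → Fin K → Fin n}
    (h : IsNearestNeighbors d j) (i : Fin n) :
    neighborSet d K i ⊆ Finset.univ.image (j i) := by
  intro x hx
  by_contra hx'
  have hcard : (Finset.univ.image (j i)).card = K := by
    rw [Finset.card_image_of_injective _ (h i).1]; simp
  have hsub : insert x (Finset.univ.image (j i)) ⊆
      Finset.univ.filter fun ℓ => d i ℓ ≤ d i x := by
    intro y hy
    rw [Finset.mem_insert] at hy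
    rw [Finset.mem_filter]
    refine ⟨Finset.mem_univ _, ?_⟩
    rcases hy with rfl | hy
    · exact le_rfl
    · obtain ⟨k, -, rfl⟩ := Finset.mem_image.1 hy
      exact (h i).2 k x (by simpa using hx')
  have h1 := Finset.card_le_card hsub
  rw [Finset.card_insert_of_notMem hx', hcard] at h1
  have h2 := (Finset.mem_filter.1 hx).2
  omega

/-- If `neighborSet` has exactly `K` elements (as it does without ties, when `K ≤ n`), the
enumerations of nearest neighbours are exactly its enumerations. -/
theorem image_eq_neighborSet {n K : ℕ} {d : Fin n → Fin n → ℝ} {j : Fin n → Fin K → Fin n}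
    (h : IsNearestNeighbors d j) (i : Fin n) (hK : (neighborSet d K i).card = K) :
    Finset.univ.image (j i) = neighborSet d K i := by
  refine (Finset.eq_of_subset_of_card_le (neighborSet_subset h i) ?_).symm
  rw [Finset.card_image_of_injective _ (h i).1, hK]; simp

end IndirectMatching

/-!
For a suitable multiple `h` of `(K / n) ^ (1 / r)`, a ball of radius `h` around a latent point has
mass of order at least `h ^ r`, because a convex set contains its own homothetic copies.
Conditionally on `α i`, the number of the other points within `h` of `α i` is a sum of independent
indicators, so Chernoff's inequality and a union bound show that with probability tending to `1`
each of these balls contains more than `K` points distinct from its center; this uses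
`log n = O(K)`.

On this event the `K` nearest neighbours of `i` are, in terms of the observed distance, no further
than the points in the ball, whose observed distance is `ρ₀ + O_P(h ^ ςup + a n)`. The offset
`ρ₀` and the noise cancel when passing back to the noise-free distance, and the lower power bound
turns `O_P(h ^ ςup + a n)` into a latent distance of order `(h ^ ςup + a n) ^ (1 / ςlow)`.
-/

namespace IndirectMatching

section StochasticOrder

variable {Ω : Type*} [MeasurableSpace Ω] {P : Measure Ω}

/-- The events `B ε n` are asymptotically negligible: the `limsup` in `n` of their probability tends
to `0` as `ε → ∞`. Both `IsBigOP` and `IsBigOmegaP` are of this form by definition, and the events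
are not required to be measurable. -/
def IsNegligible (P : Measure Ω) (B : ℝ → ℕ → Set Ω) : Prop :=
  Tendsto (fun ε => limsup (fun n => P (B ε n)) atTop) atTop (𝓝 0)

theorem IsNegligible.union {B C : ℝ → ℕ → Set Ω} (hB : IsNegligible P B) (hC : IsNegligible P C) :
    IsNegligible P fun ε n => B ε n ∪ C ε n := by
  refine ENNReal.tendsto_nhds_zero.2 fun δ hδ => ?_
  have hδ2 : 0 < δ / 2 := ENNReal.half_pos hδ.ne'
  filter_upwards [hB.eventually_lt_const hδ2, hC.eventually_lt_const hδ2] with ε hBε hCε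
  refine limsup_le_of_le (by isBoundedDefault) ?_
  filter_upwards [eventually_lt_of_limsup_lt hBε, eventually_lt_of_limsup_lt hCε] with n hBn hCn
  calc P (B ε n ∪ C ε n) ≤ P (B ε n) + P (C ε n) := measure_union_le _ _
    _ ≤ δ / 2 + δ / 2 := add_le_add hBn.le hCn.le
    _ = δ := ENNReal.add_halves δ

theorem isNegligible_of_tendsto_measure {B : ℕ → Set Ω}
    (hB : Tendsto (fun n => P (B n)) atTop (𝓝 0)) : IsNegligible P fun _ => B := by
  simp only [IsNegligible, hB.limsup_eq, tendsto_const_nhds]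

theorem IsNegligible.of_eventually_subset {B C : ℝ → ℕ → Set Ω} (hB : IsNegligible P B)
    (hC : ∀ n, Antitone fun ε => C ε n)
    (hsub : ∀ ε > 0, ∃ ε', ∀ᶠ n in atTop, C ε' n ⊆ B ε n) : IsNegligible P C := by
  refine ENNReal.tendsto_nhds_zero.2 fun δ hδ => ?_
  obtain ⟨ε, hεδ, hε⟩ :=
    ((ENNReal.tendsto_nhds_zero.1 hB δ hδ).and (eventually_gt_atTop 0)).exists
  obtain ⟨ε', hε'⟩ := hsub ε hε
  filter_upwards [eventually_ge_atTop ε'] with ε'' hε''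
  refine (limsup_le_limsup ?_).trans hεδ
  filter_upwards [hε'] with n hn
  exact measure_mono ((hC n hε'').trans hn)

end StochasticOrder

section LowerTail

theorem sum_indicator_one_eq_ncard {Ω ι : Type*} [Fintype ι] (B : ι → Set Ω) (ω : Ω) :
    ∑ i, (B i).indicator (1 : Ω → ℝ) ω = {i | ω ∈ B i}.ncard := by
  classical
  rw [Set.ncard_eq_toFinset_card']
  simp [Set.indicator_apply]

variable {Ω E ι : Type*} [MeasurableSpace Ω] [MeasurableSpace E]
  {P : Measure Ω} [IsProbabilityMeasure P]

theorem measure_prodMk_mem_le_of_indepFun {F : Type*} [MeasurableSpace F] {Y : Ω → E} {W : Ω → F}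
    (hY : Measurable Y) (hW : Measurable W) (hind : IndepFun Y W P) {S : Set (E × F)}
    (hS : MeasurableSet S) {b : ℝ≥0∞} (hb : ∀ᵐ ω ∂P, P {ω' | (Y ω, W ω') ∈ S} ≤ b) :
    P {ω | (Y ω, W ω) ∈ S} ≤ b := by
  have : IsProbabilityMeasure (P.map W) := Measure.isProbabilityMeasure_map hW.aemeasurable
  calc P {ω | (Y ω, W ω) ∈ S} = ((P.map Y).prod (P.map W)) S := by
        rw [← hind.map_prod_eq_prod_map_map hY.aemeasurable hW.aemeasurable,
          Measure.map_apply (hY.prodMk hW) hS]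
        rfl
    _ = ∫⁻ ω, P {ω' | (Y ω, W ω') ∈ S} ∂P := by
        rw [Measure.prod_apply hS, lintegral_map (measurable_measure_prodMk_left hS) hY]
        exact lintegral_congr fun ω => Measure.map_apply hW (measurable_prodMk_left hS)
    _ ≤ ∫⁻ _, b ∂P := lintegral_mono_ae hb
    _ = b := by simp

theorem mgf_indicator_one {B : Set Ω} (hB : MeasurableSet B) (t : ℝ) :
    mgf (B.indicator 1) P t = 1 + (Real.exp t - 1) * P.real B := by
  have hexp : ∀ ω, Real.exp (t * B.indicator 1 ω) = 1 + (Real.exp t - 1) * B.indicator 1 ω := by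
    intro ω
    by_cases hω : ω ∈ B <;> simp [hω]
  have hint : Integrable (B.indicator (1 : Ω → ℝ)) P := (integrable_const 1).indicator hB
  simp only [mgf, hexp]
  rw [integral_add (integrable_const 1) (hint.const_mul _), integral_const_mul,
    integral_indicator_one hB]
  simp

theorem measurable_ncard_section [Finite ι] {S : Set (E × E)} (hS : MeasurableSet S) :
    Measurable fun z : E × (ι → E) => ({i | (z.1, z.2 i) ∈ S}.ncard : ℝ) := by
  classical
  have := Fintype.ofFinite ι
  simp only [Set.ncard_eq_toFinset_card', Set.toFinset_ofPred, Finset.card_filter, Nat.cast_sum,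
    Nat.cast_ite]
  refine Finset.measurable_fun_sum _ fun i _ => Measurable.ite ?_ measurable_const measurable_const
  exact (measurable_fst.prodMk ((measurable_pi_apply i).comp measurable_snd)) hS

variable [Fintype ι]

/-- The Chernoff bound for the lower tail: the moment generating function of an indicator of
probability at least `q` is at most `exp ((exp t - 1) * q)` when `t ≤ 0`. -/
theorem measureReal_ncard_le_le_exp {X : ι → Ω → E} (hX : ∀ i, Measurable (X i))
    (hind : iIndepFun X P) {T : ι → Set E} (hT : ∀ i, MeasurableSet (T i)) {q : ℝ}
    (hq : ∀ i, q ≤ P.real (X i ⁻¹' T i)) {t : ℝ} (ht : t ≤ 0) (k : ℝ) :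
    P.real {ω | ({i | X i ω ∈ T i}.ncard : ℝ) ≤ k} ≤
      Real.exp (-t * k + Fintype.card ι * ((Real.exp t - 1) * q)) := by
  set N : ι → Ω → ℝ := fun i => (X i ⁻¹' T i).indicator 1
  have hNm : ∀ i, Measurable (N i) := fun i => measurable_one.indicator (hX i (hT i))
  have hNind : iIndepFun N P :=
    hind.comp (fun i => (T i).indicator 1) fun i => measurable_one.indicator (hT i)
  have hmgf : ∀ i, mgf (N i) P t ≤ Real.exp ((Real.exp t - 1) * q) := by
    intro i
    rw [mgf_indicator_one (hX i (hT i)), add_comm]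
    refine (Real.add_one_le_exp _).trans (Real.exp_le_exp.2 ?_)
    exact mul_le_mul_of_nonpos_left (hq i) (sub_nonpos.2 (Real.exp_le_one_iff.2 ht))
  have hint : Integrable (fun ω => Real.exp (t * (∑ i, N i) ω)) P :=
    hNind.integrable_exp_mul_sum hNm fun i _ =>
      integrable_exp_mul_of_mem_Icc (a := 0) (b := 1) (hNm i).aemeasurable
        (Eventually.of_forall fun ω => ⟨Set.indicator_nonneg (fun _ _ => zero_le_one) ω,
          Set.indicator_le_self' (fun _ _ => zero_le_one) ω⟩)
  calc P.real {ω | ({i | X i ω ∈ T i}.ncard : ℝ) ≤ k} = P.real {ω | (∑ i, N i) ω ≤ k} := by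
        simp only [Finset.sum_apply, N, sum_indicator_one_eq_ncard, Set.mem_preimage]
    _ ≤ Real.exp (-t * k) * mgf (∑ i, N i) P t := measure_le_le_exp_mul_mgf k ht hint
    _ ≤ Real.exp (-t * k) * ∏ _i : ι, Real.exp ((Real.exp t - 1) * q) := by
        rw [hNind.mgf_sum hNm]
        gcongr with i
        · exact fun i _ => mgf_nonneg
        · exact hmgf i
    _ = Real.exp (-t * k + Fintype.card ι * ((Real.exp t - 1) * q)) := by
        rw [Finset.prod_const, Finset.card_univ, ← Real.exp_nat_mul, ← Real.exp_add]

/-- Conditioning on `X i` turns the count over the other indices into a number of independent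
events, to which the Chernoff bound applies. -/
theorem measure_ncard_related_le_le_exp {X : ι → Ω → E} (hX : ∀ i, Measurable (X i))
    (hind : iIndepFun X P) {S : Set (E × E)} (hS : MeasurableSet S) (i : ι) {q : ℝ}
    (hq : ∀ᵐ ω ∂P, ∀ ℓ, q ≤ P.real (X ℓ ⁻¹' {y | (X i ω, y) ∈ S})) {t : ℝ} (ht : t ≤ 0) (k : ℝ) :
    P {ω | ({ℓ | (X i ω, X ℓ ω) ∈ S}.ncard : ℝ) ≤ k} ≤
      ENNReal.ofReal (Real.exp (-t * k + (Fintype.card ι - 1) * ((Real.exp t - 1) * q))) := by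
  classical
  set O : Finset ι := Finset.univ.erase i
  have hcard : (Fintype.card O : ℝ) = Fintype.card ι - 1 := by
    rw [Fintype.card_coe, Finset.cast_card_erase_of_mem (Finset.mem_univ i), Finset.card_univ]
  have hindep : IndepFun (X i) (fun ω (ℓ : O) => X ℓ ω) P :=
    (hind.indepFun_finset {i} O (by simp [O]) hX).comp
      (measurable_pi_apply (⟨i, Finset.mem_singleton_self i⟩ : ({i} : Finset ι))) measurable_id
  have hothers : ∀ ω, ({ℓ : O | (X i ω, X ℓ ω) ∈ S}.ncard : ℝ) ≤
      {ℓ | (X i ω, X ℓ ω) ∈ S}.ncard := by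
    intro ω
    rw [← Set.ncard_image_of_injective _ Subtype.val_injective]
    exact_mod_cast Set.ncard_le_ncard (by rintro _ ⟨ℓ, hℓ, rfl⟩; exact hℓ) (Set.toFinite _)
  refine (measure_mono fun ω hω => (hothers ω).trans hω).trans ?_
  refine measure_prodMk_mem_le_of_indepFun (hX i) (measurable_pi_lambda _ fun ℓ : O => hX ℓ) hindep
    (S := {z : E × (O → E) | ({ℓ | (z.1, z.2 ℓ) ∈ S}.ncard : ℝ) ≤ k})
    (measurableSet_le (measurable_ncard_section hS) measurable_const) ?_
  filter_upwards [hq] with ω hω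
  rw [← hcard, ← ofReal_measureReal]
  exact ENNReal.ofReal_le_ofReal (measureReal_ncard_le_le_exp (fun ℓ : O => hX ℓ)
    (hind.precomp Subtype.val_injective) (fun _ => measurable_prodMk_left hS)
    (fun ℓ => hω ℓ) ht k)

theorem measure_exists_ncard_related_le_le_exp {X : ι → Ω → E} (hX : ∀ i, Measurable (X i))
    (hind : iIndepFun X P) {S : Set (E × E)} (hS : MeasurableSet S) {q : ℝ}
    (hq : ∀ i, ∀ᵐ ω ∂P, ∀ ℓ, q ≤ P.real (X ℓ ⁻¹' {y | (X i ω, y) ∈ S})) {t : ℝ} (ht : t ≤ 0)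
    (k : ℝ) :
    P {ω | ∃ i, ({ℓ | (X i ω, X ℓ ω) ∈ S}.ncard : ℝ) ≤ k} ≤ ENNReal.ofReal (Fintype.card ι *
      Real.exp (-t * k + (Fintype.card ι - 1) * ((Real.exp t - 1) * q))) := by
  rw [Set.ofPred_exists, ENNReal.ofReal_mul (Nat.cast_nonneg _), ENNReal.ofReal_natCast,
    ← nsmul_eq_mul, ← Finset.card_univ, ← Finset.sum_const]
  exact (measure_iUnion_fintype_le _ _).trans
    (Finset.sum_le_sum fun i _ => measure_ncard_related_le_le_exp hX hind hS i (hq i) ht k)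

end LowerTail

section LowerRegular

/-- Lower Ahlfors regularity on `A` at scales up to `t₀`: balls around points of `A` have mass at
least of the order of the power `s` of their radius. The center is removed, so that the mass is not
due to an atom there. -/
def IsLowerRegularOn {E : Type*} [PseudoMetricSpace E] [MeasurableSpace E] (μ : Measure E)
    (A : Set E) (s c t₀ : ℝ) : Prop :=
  ∀ x ∈ A, ∀ t, 0 ≤ t → t ≤ t₀ →
    ENNReal.ofReal (c * t ^ s) ≤ μ (Metric.closedBall x t \ {x})

theorem ofReal_mul_measure_inter_le_withDensity {E : Type*} [MeasurableSpace E] (μ : Measure E)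
    {A T : Set E} (hA : MeasurableSet A) (hT : MeasurableSet T) {f : E → ℝ} {c : ℝ}
    (hf : ∀ x ∈ A, c ≤ f x) :
    ENNReal.ofReal c * μ (T ∩ A) ≤
      (μ.restrict A).withDensity (fun x => ENNReal.ofReal (f x)) T := by
  rw [withDensity_apply _ hT, Measure.restrict_restrict hT, ← setLIntegral_const]
  exact setLIntegral_mono' (hT.inter hA) fun x hx => ENNReal.ofReal_le_ofReal (hf x hx.2)

variable {E : Type*} [NormedAddCommGroup E] [NormedSpace ℝ E] [FiniteDimensional ℝ E]
  [MeasurableSpace E] [BorelSpace E] (μ : Measure E) [μ.IsAddHaarMeasure]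

/-- The homothety of ratio `t` centered at `x` maps `A` into itself, by convexity. -/
theorem ofReal_pow_mul_addHaar_le_addHaar_inter_closedBall {A : Set E} (hA : Convex ℝ A) {x : E}
    (hx : x ∈ A) {D : ℝ} (hD : A ⊆ Metric.closedBall x D) {t : ℝ} (ht₀ : 0 ≤ t) (ht₁ : t ≤ 1) :
    ENNReal.ofReal (t ^ Module.finrank ℝ E) * μ A ≤ μ (A ∩ Metric.closedBall x (t * D)) := by
  rw [← abs_of_nonneg (pow_nonneg ht₀ _), ← Measure.addHaar_image_homothety μ x t A]
  refine measure_mono ?_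
  rintro _ ⟨y, hy, rfl⟩
  constructor
  · rw [AffineMap.homothety_eq_lineMap]
    exact hA.lineMap_mem hx hy ⟨ht₀, ht₁⟩
  · rw [Metric.mem_closedBall, dist_homothety_center, Real.norm_of_nonneg ht₀, dist_comm]
    exact mul_le_mul_of_nonneg_left (hD hy) ht₀

theorem isLowerRegularOn_withDensity_of_convex [Nontrivial E] {A : Set E} (hAm : MeasurableSet A)
    (hA : Convex ℝ A) {D : ℝ} (hD : 0 < D) (hAD : ∀ x ∈ A, A ⊆ Metric.closedBall x D)
    {f : E → ℝ} {c : ℝ} (hc : 0 ≤ c) (hf : ∀ x ∈ A, c ≤ f x) :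
    IsLowerRegularOn ((μ.restrict A).withDensity fun x => ENNReal.ofReal (f x)) A
      (Module.finrank ℝ E) (c * (μ.real A / D ^ Module.finrank ℝ E)) D := by
  intro x hx t ht₀ htD
  have hA_ne_top : μ A ≠ ∞ := (Metric.isBounded_closedBall.subset (hAD x hx)).measure_lt_top.ne
  calc ENNReal.ofReal (c * (μ.real A / D ^ Module.finrank ℝ E) * t ^ (Module.finrank ℝ E : ℝ))
      = ENNReal.ofReal c * (ENNReal.ofReal ((t / D) ^ Module.finrank ℝ E) * μ A) := by
        rw [← ofReal_measureReal hA_ne_top, ← ENNReal.ofReal_mul (by positivity),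
          ← ENNReal.ofReal_mul hc, Real.rpow_natCast, div_pow]
        congr 1
        ring
    _ ≤ ENNReal.ofReal c * μ (A ∩ Metric.closedBall x (t / D * D)) := by
        gcongr
        exact ofReal_pow_mul_addHaar_le_addHaar_inter_closedBall μ hA hx (hAD x hx)
          (by positivity) ((div_le_one hD).2 htD)
    _ = ENNReal.ofReal c * μ ((Metric.closedBall x t \ {x}) ∩ A) := by
        rw [div_mul_cancel₀ t hD.ne', Set.inter_comm, ← Set.inter_sdiff_right_comm,
          measure_sdiff_null (measure_singleton x)]
    _ ≤ _ := ofReal_mul_measure_inter_le_withDensity μ hAm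
        (Metric.isClosed_closedBall.measurableSet.diff (measurableSet_singleton x)) hf

end LowerRegular

section RegularLatent

variable {Ω : Type*} [MeasurableSpace Ω] {P : Measure Ω} {r : ℕ} {p : ℕ → ℕ}
  {A : Set (EuclideanSpace ℝ (Fin r))} {M : ∀ n, FactorModel Ω r n (p n)}

theorem RegularLatent.ae_mem (h : RegularLatent P A M) (n : ℕ) (i : Fin n) :
    ∀ᵐ ω ∂P, (M n).α i ω ∈ A := by
  obtain ⟨hcompact, -, -, f, -, -, -, -, -, hlaw⟩ := h
  refine ae_of_ae_map ((M n).measurable_α i).aemeasurable ?_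
  rw [hlaw n i]
  exact (withDensity_absolutelyContinuous _ _).ae_le (ae_restrict_mem hcompact.measurableSet)

theorem RegularLatent.volume_pos [NeZero P] (h : RegularLatent P A M) : 0 < volume A := by
  obtain ⟨-, -, -, f, -, -, -, -, -, hlaw⟩ := h
  refine pos_iff_ne_zero.2 fun hA => ?_
  have hmap := hlaw 1 0
  rw [Measure.restrict_eq_zero.2 hA, withDensity_zero_left,
    Measure.map_eq_zero_iff ((M 1).measurable_α 0).aemeasurable] at hmap
  exact NeZero.ne P hmap

theorem RegularLatent.exists_isLowerRegularOn [NeZero P] (hr : 1 ≤ r) (h : RegularLatent P A M) :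
    ∃ c > 0, ∃ t₀ > 0, ∀ n i, IsLowerRegularOn (P.map ((M n).α i)) A r c t₀ := by
  have hvol := h.volume_pos
  obtain ⟨hcompact, hconvex, -, f, c, C, hc, -, hf, hlaw⟩ := h
  have : Nonempty (Fin r) := ⟨⟨0, hr⟩⟩
  obtain ⟨D, hD⟩ := Metric.isBounded_iff.1 hcompact.isBounded
  have hvol_real : 0 < volume.real A := ENNReal.toReal_pos hvol.ne' hcompact.measure_lt_top.ne
  refine ⟨c * (volume.real A / max D 1 ^ r), by positivity, max D 1, by positivity, fun n i => ?_⟩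
  have hreg := isLowerRegularOn_withDensity_of_convex volume hcompact.measurableSet hconvex
    (D := max D 1) (by positivity)
    (fun x hx y hy => (hD hy hx).trans (le_max_left D 1)) hc.le fun x hx => (hf n x hx).1
  rwa [← hlaw n i, finrank_euclideanSpace_fin] at hreg

end RegularLatent

section NeighborAsymptotics

theorem isBigO_log_of_tendsto_log_div_div {K : ℕ → ℝ} (hK : ∀ᶠ n in atTop, 0 < K n)
    (h : Tendsto (fun n : ℕ => Real.log (n / K n) / K n) atTop (𝓝 0)) :
    (fun n : ℕ => Real.log n) =O[atTop] K := by
  refine Asymptotics.IsBigO.of_bound 2 ?_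
  filter_upwards [hK, h.eventually_lt_const one_pos, eventually_ge_atTop 1] with n hKn hn hn1
  have hn0 : (0 : ℝ) < n := by exact_mod_cast hn1
  rw [div_lt_one hKn, Real.log_div hn0.ne' hKn.ne'] at hn
  rw [Real.norm_of_nonneg (Real.log_natCast_nonneg n), Real.norm_of_nonneg hKn.le]
  linarith [Real.log_le_self hKn.le]

theorem tendsto_div_natCast_of_tendsto_mul_log_div {K : ℕ → ℝ}
    (h : Tendsto (fun n : ℕ => K n * Real.log n / n) atTop (𝓝 0)) :
    Tendsto (fun n : ℕ => K n / n) atTop (𝓝 0) := by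
  refine squeeze_zero_norm' ?_ (tendsto_zero_iff_norm_tendsto_zero.1 h)
  filter_upwards [(Real.tendsto_log_atTop.comp tendsto_natCast_atTop_atTop).eventually_ge_atTop 1]
    with n (hn : 1 ≤ Real.log n)
  rw [mul_div_right_comm, norm_mul]
  exact le_mul_of_one_le_right (norm_nonneg _) (hn.trans (le_abs_self _))

/-- For `n ≥ 2` the exponent is at most `-2 * log n`. -/
theorem exists_tendsto_mul_exp_sub_zero {K : ℕ → ℝ} (hK : ∀ n, 0 ≤ K n)
    (hlog : (fun n : ℕ => Real.log n) =O[atTop] K) {θ : ℝ} (hθ : 0 < θ) :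
    ∃ B > 0, Tendsto (fun n : ℕ => n * Real.exp (K n - (n - 1) * (θ * (B * (K n / n)))))
      atTop (𝓝 0) := by
  obtain ⟨C, hC, hbound⟩ := hlog.exists_pos
  refine ⟨(2 + 4 * C) / θ, by positivity, ?_⟩
  refine squeeze_zero' (Eventually.of_forall fun n => by positivity) ?_
    (tendsto_one_div_atTop_nhds_zero_nat (𝕜 := ℝ))
  filter_upwards [hbound.bound, eventually_ge_atTop 2] with n hn hn2
  have hn2' : (2 : ℝ) ≤ n := by exact_mod_cast hn2
  have hn0 : (0 : ℝ) < n := by linarith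
  have hlogK : Real.log n ≤ C * K n := by
    rw [Real.norm_of_nonneg (hK n)] at hn
    exact (le_abs_self _).trans hn
  have hhalf : 1 / 2 ≤ ((n : ℝ) - 1) / n := by
    rw [div_le_div_iff₀ two_pos hn0]
    linarith
  have hexponent : K n - (n - 1) * (θ * ((2 + 4 * C) / θ * (K n / n))) ≤
      -Real.log n - Real.log n := by
    calc K n - (n - 1) * (θ * ((2 + 4 * C) / θ * (K n / n)))
        = K n - (2 + 4 * C) * K n * ((n - 1) / n) := by field_simp
      _ ≤ K n - (2 + 4 * C) * K n * (1 / 2) := by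
          have := hK n
          gcongr
      _ ≤ -Real.log n - Real.log n := by linarith
  calc n * Real.exp (K n - (n - 1) * (θ * ((2 + 4 * C) / θ * (K n / n))))
      ≤ n * Real.exp (-Real.log n - Real.log n) := by gcongr
    _ = 1 / n := by
        rw [Real.exp_sub, Real.exp_neg, Real.exp_log hn0]
        field_simp

end NeighborAsymptotics

section NeighborCount

variable {Ω E : Type*} [MeasurableSpace Ω] {P : Measure Ω} [IsProbabilityMeasure P]
  [MetricSpace E] [SecondCountableTopology E] [MeasurableSpace E] [OpensMeasurableSpace E]
  {A : Set E} {s c t₀ : ℝ}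

theorem measure_exists_ncard_closedBall_le_le_exp {ι : Type*} [Fintype ι] {X : ι → Ω → E}
    (hX : ∀ i, Measurable (X i)) (hind : iIndepFun X P) (hA : ∀ i, ∀ᵐ ω ∂P, X i ω ∈ A)
    (hreg : ∀ i, IsLowerRegularOn (P.map (X i)) A s c t₀) {h : ℝ} (hh₀ : 0 ≤ h) (hh : h ≤ t₀)
    (k : ℝ) :
    P {ω | ∃ i, ({ℓ | X ℓ ω ∈ Metric.closedBall (X i ω) h \ {X i ω}}.ncard : ℝ) ≤ k} ≤
      ENNReal.ofReal (Fintype.card ι *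
        Real.exp (k - (Fintype.card ι - 1) * ((1 - Real.exp (-1)) * (c * h ^ s)))) := by
  have hS : MeasurableSet {z : E × E | z.2 ∈ Metric.closedBall z.1 h \ {z.1}} :=
    (measurableSet_le (measurable_snd.dist measurable_fst) measurable_const).diff
      (measurableSet_eq_fun measurable_snd measurable_fst)
  have hmass : ∀ i, ∀ᵐ ω ∂P, ∀ ℓ,
      c * h ^ s ≤ P.real (X ℓ ⁻¹' (Metric.closedBall (X i ω) h \ {X i ω})) := by
    intro i
    filter_upwards [hA i] with ω hω ℓ
    have hball := hreg ℓ (X i ω) hω h hh₀ hh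
    rw [Measure.map_apply (hX ℓ)
      (Metric.isClosed_closedBall.measurableSet.diff (measurableSet_singleton _))] at hball
    exact (ENNReal.ofReal_le_iff_le_toReal (measure_ne_top _ _)).1 hball
  rw [show k - (Fintype.card ι - 1) * ((1 - Real.exp (-1)) * (c * h ^ s)) =
    -(-1) * k + (Fintype.card ι - 1) * ((Real.exp (-1) - 1) * (c * h ^ s)) by ring]
  exact measure_exists_ncard_related_le_le_exp hX hind hS hmass (by norm_num) k

theorem exists_tendsto_measure_exists_ncard_closedBall_le {X : ∀ n, Fin n → Ω → E}
    (hX : ∀ n i, Measurable (X n i)) (hind : ∀ n, iIndepFun (X n) P)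
    (hA : ∀ n i, ∀ᵐ ω ∂P, X n i ω ∈ A) (hs : 0 < s) (hc : 0 < c) (ht₀ : 0 < t₀)
    (hreg : ∀ n i, IsLowerRegularOn (P.map (X n i)) A s c t₀) {K : ℕ → ℝ} (hK : ∀ n, 0 ≤ K n)
    (hlog : (fun n : ℕ => Real.log n) =O[atTop] K)
    (hsmall : Tendsto (fun n : ℕ => K n / n) atTop (𝓝 0)) :
    ∃ L ≥ 0, Tendsto (fun n => P {ω | ∃ i, ({ℓ | X n ℓ ω ∈
      Metric.closedBall (X n i ω) (L * (K n / n) ^ (1 / s)) \ {X n i ω}}.ncard : ℝ) ≤ K n})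
      atTop (𝓝 0) := by
  obtain ⟨B, hB, hlim⟩ := exists_tendsto_mul_exp_sub_zero hK hlog
    (sub_pos.2 (Real.exp_lt_one_iff.2 neg_one_lt_zero))
  set L : ℝ := (B / c) ^ (1 / s)
  have hrate : ∀ n : ℕ, 0 ≤ K n / n := fun n => div_nonneg (hK n) n.cast_nonneg
  have hradius_pow : ∀ n : ℕ, c * (L * (K n / n) ^ (1 / s)) ^ s = B * (K n / n) := by
    intro n
    rw [← Real.mul_rpow (by positivity) (hrate n), ← Real.rpow_mul (by have := hrate n; positivity),
      one_div_mul_cancel hs.ne', Real.rpow_one]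
    field_simp
  have hradius_lim : Tendsto (fun n : ℕ => L * (K n / n) ^ (1 / s)) atTop (𝓝 0) := by
    simpa [hs.ne'] using (hsmall.rpow_const (Or.inr (by positivity : 0 ≤ 1 / s))).const_mul L
  refine ⟨L, by positivity, tendsto_of_tendsto_of_tendsto_of_le_of_le' tendsto_const_nhds
    (ENNReal.ofReal_zero ▸ ENNReal.tendsto_ofReal hlim) (Eventually.of_forall fun _ => zero_le) ?_⟩
  filter_upwards [hradius_lim.eventually_le_const ht₀] with n hn
  have hbound := measure_exists_ncard_closedBall_le_le_exp (hX n) (hind n) (hA n) (hreg n)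
    (mul_nonneg (by positivity) (Real.rpow_nonneg (hrate n) _)) hn (K n)
  rwa [hradius_pow, Fintype.card_fin] at hbound

end NeighborCount

section NearestNeighbors

theorem lt_mul_of_abs_iSup_div_lt {ι : Type*} [Finite ι] {f : ι → ℝ} {b ε : ℝ} (hb : 0 < b)
    (h : |(⨆ i, f i) / b| < ε) (i : ι) : f i < ε * b :=
  (le_ciSup (Set.finite_range f).bddAbove i).trans_lt
    ((div_lt_iff₀ hb).1 ((le_abs_self _).trans_lt h))

theorem lt_mul_of_lt_mul_iInf {ι : Type*} [Finite ι] {f : ι → ℝ} {b ε : ℝ} (hε : 0 ≤ ε)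
    (h : b < ε * ⨅ i, f i) (i : ι) : b < ε * f i :=
  h.trans_le (mul_le_mul_of_nonneg_left (ciInf_le (Set.finite_range f).bddBelow i) hε)

theorem abs_iSup_iSup_div_le {ι κ : Type*} {f : ι → κ → ℝ} (hf : ∀ i k, 0 ≤ f i k) {b G : ℝ}
    (hb : 0 < b) (hG : 0 ≤ G) (h : ∀ i k, f i k ≤ G * b) : |(⨆ i, ⨆ k, f i k) / b| ≤ G := by
  have hnonneg : 0 ≤ ⨆ i, ⨆ k, f i k := Real.iSup_nonneg fun i => Real.iSup_nonneg (hf i)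
  rw [abs_of_nonneg (by positivity), div_le_iff₀ hb]
  exact Real.iSup_le (fun i => Real.iSup_le (h i) (by positivity)) (by positivity)

theorem le_rpow_mul_of_rpow_le {D G y s : ℝ} (hD : 0 ≤ D) (hG : 0 ≤ G) (hy : 0 ≤ y) (hs : 0 < s)
    (h : D ^ s ≤ G * y ^ s) : D ≤ G ^ (1 / s) * y := by
  refine (Real.rpow_le_rpow_iff hD (by positivity) hs).1 (h.trans_eq ?_)
  rw [Real.mul_rpow (by positivity) hy, ← Real.rpow_mul hG, one_div_mul_cancel hs.ne',
    Real.rpow_one]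

theorem mul_rpow_add_mul_rpow_le {u v b c s : ℝ} (hu : 0 ≤ u) (hv : 0 ≤ v) (hb : 0 ≤ b)
    (hc : 0 ≤ c) (hs : 0 ≤ s) : b * u ^ s + c * v ^ s ≤ (b + c) * (u + v) ^ s := by
  rw [add_mul]
  gcongr <;> linarith

variable {n K : ℕ} {dhat d : Fin n → Fin n → ℝ} {j : Fin n → Fin K → Fin n}

theorem IsNearestNeighbors.le_of_le_ncard (hj : IsNearestNeighbors d j) {i : Fin n} {b : ℝ}
    (hb : K ≤ {ℓ | d i ℓ ≤ b}.ncard) (k : Fin K) : d i (j i k) ≤ b := by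
  by_contra! hfar
  have hsub : {ℓ | d i ℓ ≤ b} ⊆ Set.range (j i) \ {j i k} := by
    refine fun ℓ hℓ => ⟨?_, ?_⟩
    · by_contra hout
      exact (((hj i).2 k ℓ hout).trans hℓ).not_gt hfar
    · rintro rfl
      exact hfar.not_ge hℓ
  have hrange : (Set.range (j i)).ncard = K := by
    rw [← Set.image_univ, Set.ncard_image_of_injective _ (hj i).1, Set.ncard_univ, Nat.card_fin]
  have hlt := Set.ncard_sdiff_singleton_lt_of_mem (Set.mem_range_self (f := j i) k)
    (Set.toFinite _)
  exact (hrange ▸ hlt).not_ge (hb.trans (Set.ncard_le_ncard hsub))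

/-- In terms of `dhat`, each neighbour is no further than the furthest of the points within `h` of
`x i`; the offset `ρ₀` cancels in this comparison. -/
theorem IsNearestNeighbors.dist_rpow_le {E : Type*} [PseudoMetricSpace E] {x : Fin n → E}
    (hj : IsNearestNeighbors dhat j) {ρ₀ e₁ e₂ e₃ h ςlow ςup : ℝ}
    (he₁ : 0 ≤ e₁) (he₂ : 0 ≤ e₂) (he₃ : 0 ≤ e₃) (hh : 0 ≤ h) (hςlow : ςlow ≠ 0) (hςup : 0 ≤ ςup)
    (hdenoise : ∀ i ℓ, i ≠ ℓ → |dhat i ℓ - d i ℓ - ρ₀| ≤ e₁)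
    (hupper : ∀ i ℓ, x i ≠ x ℓ → d i ℓ ≤ e₂ * dist (x i) (x ℓ) ^ ςup)
    (hlower : ∀ i ℓ, x i ≠ x ℓ → dist (x i) (x ℓ) ^ ςlow ≤ e₃ * d i ℓ) {i : Fin n}
    (hball : K ≤ {ℓ | x ℓ ∈ Metric.closedBall (x i) h \ {x i}}.ncard) (k : Fin K) :
    dist (x i) (x (j i k)) ^ ςlow ≤ e₃ * (e₂ * h ^ ςup + 2 * e₁) := by
  have hnear : {ℓ | x ℓ ∈ Metric.closedBall (x i) h \ {x i}} ⊆
      {ℓ | dhat i ℓ ≤ e₂ * h ^ ςup + ρ₀ + e₁} := by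
    rintro ℓ ⟨hℓh, hℓne⟩
    have hne : x i ≠ x ℓ := fun heq => hℓne heq.symm
    have hd : d i ℓ ≤ e₂ * h ^ ςup := (hupper i ℓ hne).trans <|
      mul_le_mul_of_nonneg_left
        (Real.rpow_le_rpow dist_nonneg (Metric.mem_closedBall'.1 hℓh) hςup) he₂
    have := (abs_le.1 (hdenoise i ℓ (ne_of_apply_ne x hne))).2
    exact (by linarith : dhat i ℓ ≤ e₂ * h ^ ςup + ρ₀ + e₁)
  have hneighbor := hj.le_of_le_ncard (hball.trans (Set.ncard_le_ncard hnear)) k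
  by_cases hne : x i = x (j i k)
  · rw [hne, dist_self, Real.zero_rpow hςlow]
    positivity
  · have := (abs_le.1 (hdenoise i (j i k) (ne_of_apply_ne x hne))).1
    exact (hlower i _ hne).trans (mul_le_mul_of_nonneg_left (by linarith) he₃)

theorem IsNearestNeighbors.dist_le_rate {E : Type*} [MetricSpace E] {x : Fin n → E}
    (hj : IsNearestNeighbors dhat j) {ρ₀ a ε L κ ςlow ςup s : ℝ}
    (ha : 0 < a) (hε : 0 < ε) (hL : 0 ≤ L) (hκ : 0 ≤ κ) (hςlow : 0 < ςlow) (hςup : 0 ≤ ςup)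
    (hdenoise : |(⨆ q : {q : Fin n × Fin n // q.1 ≠ q.2},
      |dhat q.1.1 q.1.2 - d q.1.1 q.1.2 - ρ₀|) / a| < ε)
    (hupper : |(⨆ q : {q : Fin n × Fin n // x q.1 ≠ x q.2},
      d q.1.1 q.1.2 / dist (x q.1.1) (x q.1.2) ^ ςup) / 1| < ε)
    (hlower : 1 < ε * ⨅ q : {q : Fin n × Fin n // x q.1 ≠ x q.2},
      d q.1.1 q.1.2 / dist (x q.1.1) (x q.1.2) ^ ςlow) {i : Fin n}
    (hball : K ≤ {ℓ | x ℓ ∈ Metric.closedBall (x i) (L * κ ^ (1 / s)) \ {x i}}.ncard)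
    (k : Fin K) :
    dist (x i) (x (j i k)) ≤
      (ε * (ε * L ^ ςup + 2 * ε)) ^ (1 / ςlow) * (κ ^ (ςup / (ςlow * s)) + a ^ (1 / ςlow)) := by
  have hupper_le : ∀ i ℓ, x i ≠ x ℓ → d i ℓ ≤ ε * dist (x i) (x ℓ) ^ ςup := by
    intro i ℓ hne
    have hratio := lt_mul_of_abs_iSup_div_lt one_pos hupper ⟨(i, ℓ), hne⟩
    rw [mul_one, div_lt_iff₀ (Real.rpow_pos_of_pos (dist_pos.2 hne) ςup)] at hratio
    exact hratio.le
  have hlower_le : ∀ i ℓ, x i ≠ x ℓ → dist (x i) (x ℓ) ^ ςlow ≤ ε * d i ℓ := by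
    intro i ℓ hne
    have hratio := lt_mul_of_lt_mul_iInf hε.le hlower ⟨(i, ℓ), hne⟩
    rw [← mul_div_assoc, one_lt_div (Real.rpow_pos_of_pos (dist_pos.2 hne) ςlow)] at hratio
    exact hratio.le
  have hκ_pow : (L * κ ^ (1 / s)) ^ ςup = L ^ ςup * (κ ^ (ςup / (ςlow * s))) ^ ςlow := by
    rw [Real.mul_rpow hL (by positivity), ← Real.rpow_mul hκ, ← Real.rpow_mul hκ]
    congr 2
    field_simp
  have ha_pow : a = (a ^ (1 / ςlow)) ^ ςlow := by
    rw [← Real.rpow_mul ha.le, one_div_mul_cancel hςlow.ne', Real.rpow_one]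
  refine le_rpow_mul_of_rpow_le dist_nonneg (by positivity) (by positivity) hςlow ?_
  calc dist (x i) (x (j i k)) ^ ςlow ≤ ε * (ε * (L * κ ^ (1 / s)) ^ ςup + 2 * (ε * a)) :=
        hj.dist_rpow_le (by positivity) hε.le hε.le (by positivity) hςlow.ne' hςup
          (fun i ℓ hne => (lt_mul_of_abs_iSup_div_lt ha hdenoise ⟨(i, ℓ), hne⟩).le)
          hupper_le hlower_le hball k
    _ = ε * (ε * L ^ ςup) * (κ ^ (ςup / (ςlow * s))) ^ ςlow +
          ε * (2 * ε) * (a ^ (1 / ςlow)) ^ ςlow := by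
        rw [hκ_pow, ← ha_pow]
        ring
    _ ≤ ε * (ε * L ^ ςup + 2 * ε) * (κ ^ (ςup / (ςlow * s)) + a ^ (1 / ςlow)) ^ ςlow := by
        rw [mul_add ε]
        exact mul_rpow_add_mul_rpow_le (by positivity) (by positivity) (by positivity)
          (by positivity) hςlow.le

end NearestNeighbors

end IndirectMatching

theorem mainTheorem1_general {Ω E : Type*} [MeasurableSpace Ω] (P : Measure Ω)
    [IsProbabilityMeasure P] [MetricSpace E] [SecondCountableTopology E] [MeasurableSpace E]
    [OpensMeasurableSpace E] {X : ∀ n, Fin n → Ω → E} (hX : ∀ n i, Measurable (X n i))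
    (hind : ∀ n, iIndepFun (X n) P) {A : Set E} (hA : ∀ n i, ∀ᵐ ω ∂P, X n i ω ∈ A)
    {s c t₀ : ℝ} (hs : 0 < s) (hc : 0 < c) (ht₀ : 0 < t₀)
    (hreg : ∀ n i, IndirectMatching.IsLowerRegularOn (P.map (X n i)) A s c t₀)
    (dhat d : ∀ n, Ω → Fin n → Fin n → ℝ) {ρ₀ ςlow ςup : ℝ} (hςlow : 0 < ςlow) (hςup : 0 ≤ ςup)
    {a : ℕ → ℝ} (ha : ∀ n, 0 < a n)
    (hdenoise : IndirectMatching.IsBigOP P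
      (fun n ω => ⨆ q : {q : Fin n × Fin n // q.1 ≠ q.2},
        |dhat n ω q.1.1 q.1.2 - d n ω q.1.1 q.1.2 - ρ₀|) a)
    (hupper : IndirectMatching.IsBigOP P
      (fun n ω => ⨆ q : {q : Fin n × Fin n // X n q.1 ω ≠ X n q.2 ω},
        d n ω q.1.1 q.1.2 / dist (X n q.1.1 ω) (X n q.1.2 ω) ^ ςup) fun _ => 1)
    (hlower : IndirectMatching.IsBigOmegaP P
      (fun n ω => ⨅ q : {q : Fin n × Fin n // X n q.1 ω ≠ X n q.2 ω},
        d n ω q.1.1 q.1.2 / dist (X n q.1.1 ω) (X n q.1.2 ω) ^ ςlow) fun _ => 1)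
    {K : ℕ → ℕ} (hlog : (fun n : ℕ => Real.log n) =O[atTop] fun n => (K n : ℝ))
    (hK : Tendsto (fun n : ℕ => (K n : ℝ) / n) atTop (𝓝 0))
    {j : ∀ n, Ω → Fin n → Fin (K n) → Fin n}
    (hj : ∀ n ω, IndirectMatching.IsNearestNeighbors (dhat n ω) (j n ω)) :
    IndirectMatching.IsBigOP P
      (fun n ω => ⨆ i : Fin n, ⨆ k : Fin (K n), dist (X n i ω) (X n (j n ω i k) ω))
      (fun n => ((K n : ℝ) / n) ^ (ςup / (ςlow * s)) + a n ^ (1 / ςlow)) := by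
  obtain ⟨L, hL, hball⟩ := IndirectMatching.exists_tendsto_measure_exists_ncard_closedBall_le
    hX hind hA hs hc ht₀ hreg (fun n => (K n).cast_nonneg) hlog hK
  have hbad := ((IndirectMatching.IsNegligible.union hdenoise hupper).union hlower).union
    (IndirectMatching.isNegligible_of_tendsto_measure hball)
  refine hbad.of_eventually_subset (fun n ε ε' hε ω hω => hε.trans hω) fun ε hε => ?_
  set G : ℝ := (ε * (ε * L ^ ςup + 2 * ε)) ^ (1 / ςlow)
  refine ⟨G + 1, Eventually.of_forall fun n ω hfar => ?_⟩
  by_contra hgood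
  simp only [Set.mem_union, Set.mem_ofPred_eq, not_or, not_le, not_exists, Nat.cast_lt] at hgood
  obtain ⟨⟨⟨hden, hup⟩, hlow⟩, hcount⟩ := hgood
  have hrate : 0 < ((K n : ℝ) / n) ^ (ςup / (ςlow * s)) + a n ^ (1 / ςlow) :=
    add_pos_of_nonneg_of_pos (by positivity) (Real.rpow_pos_of_pos (ha n) _)
  have hdist := IndirectMatching.abs_iSup_iSup_div_le (fun _ _ => dist_nonneg) hrate
    (by positivity) fun i k => (hj n ω).dist_le_rate (x := fun i => X n i ω) (ha n) hε hL
      (by positivity) hςlow hςup hden hup hlow (hcount i).le k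
  exact (lt_add_one G).not_ge (hfar.trans hdist)

theorem mainTheorem1 {Ω : Type*} [MeasurableSpace Ω] (P : Measure Ω) [IsProbabilityMeasure P]
    (r : ℕ) (hr : 1 ≤ r) (p : ℕ → ℕ)
    (M : ∀ n, IndirectMatching.FactorModel Ω r n (p n))
    (A : Set (EuclideanSpace ℝ (Fin r)))
    (hmean : IndirectMatching.ErrorsCentered P M)
    (hlatent : IndirectMatching.RegularLatent P A M)
    (hfunctions : IndirectMatching.RegularFunctions P A M)
    (herrors : IndirectMatching.RegularErrors P M)
    (R : ∀ n, Finset (Fin (p n)))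
    (ρ : ∀ n, IndirectMatching.DistanceRule n (R n))
    (ρ₀ ςlow ςup : ℝ) (hρ₀ : 0 ≤ ρ₀) (hςlow : 0 < ςlow) (hςup : 0 < ςup)
    (a : ℕ → ℝ) (ha_pos : ∀ n, 0 < a n) (ha : Tendsto a atTop (𝓝 0))
    (hdenoise : IndirectMatching.Denoises P M R ρ ρ₀ a)
    (hupper : IndirectMatching.UpperPower P M R ρ ςup)
    (hlower : IndirectMatching.LowerPower P M R ρ ςlow)
    (K : ℕ → ℕ) (hK : ∀ n, 1 ≤ n → 1 ≤ K n ∧ K n ≤ n)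
    (hK_large : Tendsto (fun n : ℕ => Real.log ((n : ℝ) / K n) / K n) atTop (𝓝 0))
    (hK_small : Tendsto (fun n : ℕ => (K n : ℝ) * Real.log n / n) atTop (𝓝 0))
    (j : ∀ n, Ω → Fin n → Fin (K n) → Fin n)
    (hj : ∀ n ω, IndirectMatching.IsNearestNeighbors
      (ρ n (IndirectMatching.rows (R n) ((M n).X ω))) (j n ω)) :
    IndirectMatching.IsBigOP P
      (fun n ω => ⨆ i : Fin n, ⨆ k : Fin (K n), ‖(M n).α i ω - (M n).α (j n ω i k) ω‖)
      (fun n => ((K n : ℝ) / n) ^ (ςup / (ςlow * r)) + a n ^ (1 / ςlow)) := by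
  obtain ⟨c, hc, t₀, ht₀, hreg⟩ := hlatent.exists_isLowerRegularOn hr
  have hK_pos : ∀ᶠ n in atTop, 0 < (K n : ℝ) := by
    filter_upwards [eventually_ge_atTop 1] with n hn
    exact_mod_cast (hK n hn).1
  simp only [IndirectMatching.UpperPower, IndirectMatching.LowerPower, ← dist_eq_norm]
    at hupper hlower ⊢
  exact mainTheorem1_general P (fun n => (M n).measurable_α) hlatent.2.2.1 hlatent.ae_mem
    (Nat.cast_pos.2 hr) hc ht₀ hreg _ _ hςlow hςup.le ha_pos hdenoise hupper hlower
    (IndirectMatching.isBigO_log_of_tendsto_log_div_div hK_pos hK_large)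
    (IndirectMatching.tendsto_div_natCast_of_tendsto_mul_log_div hK_small) hj
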